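/- Let $X$ be a Hausdorff, locally compact, second countable topological space and let $\mu$ be a $\sigma$-finite, locally finite Borel measure on $X$ that is non-degenerate (nonempty open sets have positive measure); $\mu(X)=\infty$ is allowed. Let $\{A_n\}_{n\ge 0}$ be a sequence of open sets with compact closures that covers $X$, and let $\{U_n\}_{n\ge 0}$ be an enumeration (repetitions allowed) of a basis of the topology of $X$. Define partitions $\mathcal P_n$ of $X$ by $$\mathcal P_0=\{A_n\setminus\overline{A_0\cup\dots\cup A_{n-1}}: n\ge 0\}\cup\{\partial A_n\setminus\overline{A_0\cup\dots\cup A_{n-1}}: n\ge 0\},$$ $$\mathcal P_{n+1}=\{U_n\cap S: S\in\mathcal P_n\}\cup\{(X\setminus\overline{U_n})\cap S: S\in\mathcal P_n\}\cup\{\partial U_n\cap S: S\in\mathcal P_n\},$$ and let $O_n(x)$ be the unique element of $\mathcal P_n$ that contains $x$. For $K\in L^2(X\times X,\mu\times\mu)$, complex-valued, put $$E_n(K)(u,v)=\frac{1}{\mu(O_n(u))\,\mu(O_n(v))}\int_{O_n(u)}\int_{O_n(v)}K(x,y)\,d\mu(y)\,d\mu(x)$$ whenever $\mu(O_n(u))\mu(O_n(v))\neq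 0$, and $E_n(K)(u,v)=0$ otherwise (the set of $u$ with $\mu(O_n(u))=0$ is $\mu$-null). Let $\mathcal K$ be the integral operator $\mathcal K(f)=\int_X K(\cdot,y)f(y)\,d\mu(y)$ on $L^2(X,\mu)$. Theorem. Suppose that $K$ is $L^2(X,\mu)$-positive definite, i.e. $\langle\mathcal K(f),f\rangle\ge 0$ for all $f\in L^2(X,\mu)$, and that $\mathcal K$ is trace-class, i.e. $\sum_{f\in\mathfrak B}\langle(\mathcal K^*\mathcal K)^{1/2}f,f\rangle<\infty$ for every orthonormal basis $\mathfrak B$ of $L^2(X,\mu)$. Then, for every $n\ge 0$, the function $x\mapsto E_n(K)(x,x)$ is $\mu$-integrable, and the limit $$\lim_{n\to\infty}\int_X E_n(K)(x,x)\,d\mu(x)$$ exists and is a finite real number. -/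

import Mathlib

open MeasureTheory Filter Topology

universe u

noncomputable section

/-! ### Trace-class operators -/

/-- A bounded operator `T` on a complex Hilbert space is trace-class when, for every orthonormal
basis `(b i)`, the series of the numbers `⟨|T| (b i), b i⟩ ≥ 0` converges, where
`|T| = (T* T)^(1/2)` is the absolute value of `T` (Mathlib's `CFC.abs`). -/
def IsTraceClassOp {H : Type u} [NormedAddCommGroup H] [InnerProductSpace ℂ H] [CompleteSpace H]
    (T : H →L[ℂ] H) : Prop :=
  ∀ (ι : Type u) (b : HilbertBasis ι ℂ H),
    Summable fun i : ι => (inner ℂ (CFC.abs T (b i)) (b i)).re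

/-! ### Integral operators on `L²` -/

section IntegralOperator

variable {X : Type u} [MeasurableSpace X] {μ : Measure X} [SFinite μ] {K : X × X → ℂ}

/-- Almost every section `K (x, ·)` of a square-integrable kernel is square-integrable. -/
theorem ae_memLp_section (hK : MemLp K 2 (μ.prod μ)) :
    ∀ᵐ x ∂μ, MemLp (fun y => K (x, y)) 2 μ := by
  have h1 : ∫⁻ z, ‖K z‖ₑ ^ (2 : ℝ) ∂(μ.prod μ) < ⊤ := by
    have := eLpNorm_nnreal_pow_eq_lintegral (f := K) (μ := μ.prod μ) (p := 2) two_ne_zero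
    simp only [NNReal.coe_ofNat, ENNReal.coe_ofNat] at this
    rw [← this]
    exact ENNReal.rpow_lt_top_of_nonneg (by norm_num) hK.2.ne
  rw [lintegral_prod _ (hK.1.enorm.pow_const _)] at h1
  have h2 := ae_lt_top' (AEMeasurable.lintegral_prod_right' (hK.1.enorm.pow_const _)) h1.ne
  filter_upwards [h2, hK.1.prodMk_left] with x hx hm
  refine ⟨hm, ?_⟩
  have := eLpNorm_nnreal_pow_eq_lintegral (f := fun y => K (x, y)) (μ := μ) (p := 2) two_ne_zero
  simp only [NNReal.coe_ofNat, ENNReal.coe_ofNat] at this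
  rw [← this] at hx
  exact (ENNReal.rpow_lt_top_iff_of_pos (by norm_num)).1 hx

/-- The Hilbert–Schmidt bound. -/
theorem eLpNorm_kernelIntegral_le (hK : MemLp K 2 (μ.prod μ)) {f : X → ℂ} (hf : MemLp f 2 μ) :
    eLpNorm (fun x => ∫ y, K (x, y) * f y ∂μ) 2 μ
      ≤ eLpNorm K 2 (μ.prod μ) * eLpNorm f 2 μ := by
  have key : ∀ᵐ x ∂μ, ‖∫ y, K (x, y) * f y ∂μ‖ₑ ^ (2 : ℝ)
      ≤ (∫⁻ y, ‖K (x, y)‖ₑ ^ (2 : ℝ) ∂μ) * eLpNorm f 2 μ ^ (2 : ℝ) := by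
    filter_upwards [ae_memLp_section hK] with x hx
    have h1 : ‖∫ y, K (x, y) * f y ∂μ‖ₑ ≤ eLpNorm (fun y => K (x, y)) 2 μ * eLpNorm f 2 μ := by
      refine (enorm_integral_le_lintegral_enorm _).trans ?_
      rw [← eLpNorm_one_eq_lintegral_enorm]
      have h2 := eLpNorm_smul_le_mul_eLpNorm (μ := μ) (p := 2) (q := 2) (r := 1) hf.1 hx.1
      exact h2
    have := eLpNorm_nnreal_pow_eq_lintegral (f := fun y => K (x, y)) (μ := μ) (p := 2) two_ne_zero
    simp only [NNReal.coe_ofNat, ENNReal.coe_ofNat] at this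
    rw [← this, ← ENNReal.mul_rpow_of_nonneg _ _ (by norm_num)]
    exact ENNReal.rpow_le_rpow h1 (by norm_num)
  rw [← ENNReal.rpow_le_rpow_iff (z := 2) (by norm_num),
    ENNReal.mul_rpow_of_nonneg _ _ (by norm_num)]
  have e1 := eLpNorm_nnreal_pow_eq_lintegral (f := fun x => ∫ y, K (x, y) * f y ∂μ) (μ := μ)
    (p := 2) two_ne_zero
  have e2 := eLpNorm_nnreal_pow_eq_lintegral (f := K) (μ := μ.prod μ) (p := 2) two_ne_zero
  simp only [NNReal.coe_ofNat, ENNReal.coe_ofNat] at e1 e2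
  rw [e1, e2, lintegral_prod _ (hK.1.enorm.pow_const _)]
  refine (lintegral_mono_ae key).trans_eq ?_
  rw [lintegral_mul_const'']
  exact AEMeasurable.lintegral_prod_right' (hK.1.enorm.pow_const _)

theorem memLp_kernelIntegral (hK : MemLp K 2 (μ.prod μ)) {f : X → ℂ} (hf : MemLp f 2 μ) :
    MemLp (fun x => ∫ y, K (x, y) * f y ∂μ) 2 μ := by
  refine ⟨?_, (eLpNorm_kernelIntegral_le hK hf).trans_lt (ENNReal.mul_lt_top hK.2 hf.2)⟩
  exact (hK.1.mul hf.1.comp_snd).integral_prod_right'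

theorem ae_integrable_section_mul (hK : MemLp K 2 (μ.prod μ)) {f : X → ℂ} (hf : MemLp f 2 μ) :
    ∀ᵐ x ∂μ, Integrable (fun y => K (x, y) * f y) μ := by
  filter_upwards [ae_memLp_section hK] with x hx
  exact hx.integrable_mul hf

/-- The integral operator `f ↦ ∫ K(·, y) f(y) dμ(y)` on `L²(X, μ)` generated by a kernel `K` in
`L²(X × X, μ × μ)`, as a bounded operator. -/
def integralOperator (hK : MemLp K 2 (μ.prod μ)) : Lp ℂ 2 μ →L[ℂ] Lp ℂ 2 μ :=
  LinearMap.mkContinuous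
    { toFun := fun f => (memLp_kernelIntegral hK (Lp.memLp f)).toLp
        (fun x => ∫ y, K (x, y) * f y ∂μ)
      map_add' := by
        intro f g
        rw [← MemLp.toLp_add, MemLp.toLp_eq_toLp_iff]
        filter_upwards [ae_integrable_section_mul hK (Lp.memLp f),
          ae_integrable_section_mul hK (Lp.memLp g)] with x hf hg
        rw [Pi.add_apply, ← integral_add hf hg]
        refine integral_congr_ae ?_
        filter_upwards [Lp.coeFn_add f g] with y hy
        rw [hy, Pi.add_apply, mul_add]
      map_smul' := by
        intro c f
        rw [RingHom.id_apply, ← MemLp.toLp_const_smul, MemLp.toLp_eq_toLp_iff]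
        refine Filter.Eventually.of_forall fun x => ?_
        simp only [Pi.smul_apply, smul_eq_mul]
        rw [← integral_const_mul]
        refine integral_congr_ae ?_
        filter_upwards [Lp.coeFn_smul c f] with y hy
        rw [hy, Pi.smul_apply, smul_eq_mul, mul_left_comm] }
    (eLpNorm K 2 (μ.prod μ)).toReal
    (by
      intro f
      simp only [LinearMap.coe_mk, AddHom.coe_mk]
      rw [Lp.norm_toLp, Lp.norm_def, ← ENNReal.toReal_mul]
      exact ENNReal.toReal_mono (ENNReal.mul_ne_top hK.2.ne (Lp.eLpNorm_ne_top f))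
        (eLpNorm_kernelIntegral_le hK (Lp.memLp f)))

theorem integralOperator_ae_eq (hK : MemLp K 2 (μ.prod μ)) (f : Lp ℂ 2 μ) :
    integralOperator hK f =ᵐ[μ] fun x => ∫ y, K (x, y) * f y ∂μ :=
  MemLp.coeFn_toLp (memLp_kernelIntegral hK (Lp.memLp f))

/-- `K` is `L²(X, μ)`-positive definite: `⟨𝒦 f, f⟩` is a nonnegative real number for all
`f ∈ L²(X, μ)`, where `𝒦` is the integral operator generated by `K`. -/
def IsL2PositiveDefinite (hK : MemLp K 2 (μ.prod μ)) : Prop :=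
  ∀ f : Lp ℂ 2 μ, 0 ≤ (inner ℂ (integralOperator hK f) f).re ∧
    (inner ℂ (integralOperator hK f) f).im = 0

end IntegralOperator

/-! ### The partitions and the averaged kernels -/

section Averaging

variable {X : Type u}

/-- The refining sequence of partitions built from a sequence `A` of open sets covering `X` and a
sequence `U` enumerating a basis of the topology. The partition at stage `0` consists of the sets
`Aₙ ∖ cl(A₀ ∪ ⋯ ∪ Aₙ₋₁)` and `∂Aₙ ∖ cl(A₀ ∪ ⋯ ∪ Aₙ₋₁)`; the partition at stage `n + 1` consists of
the intersections of the elements of the partition at stage `n` with `Uₙ`, with `X ∖ cl(Uₙ)` and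
with `∂Uₙ`. -/
def cellPartition [TopologicalSpace X] (A U : ℕ → Set X) : ℕ → Set (Set X)
  | 0 => (Set.range fun n => A n \ closure (⋃ m < n, A m)) ∪
      (Set.range fun n => frontier (A n) \ closure (⋃ m < n, A m))
  | n + 1 => ((fun S => U n ∩ S) '' cellPartition A U n) ∪
      ((fun S => (closure (U n))ᶜ ∩ S) '' cellPartition A U n) ∪
      ((fun S => frontier (U n) ∩ S) '' cellPartition A U n)

/-- The element `Oₙ(x)` of the `n`-th partition that contains `x`, written as the union of all the
elements that contain `x` (there is exactly one, see `existsUnique_cell` and `cell_mem`). -/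
def cell [TopologicalSpace X] (A U : ℕ → Set X) (n : ℕ) (x : X) : Set X :=
  ⋃₀ {S | S ∈ cellPartition A U n ∧ x ∈ S}

theorem existsUnique_cell [TopologicalSpace X] {A U : ℕ → Set X} (hA : ∀ n, IsOpen (A n))
    (hcov : ⋃ n, A n = Set.univ) (hU : ∀ n, IsOpen (U n)) (n : ℕ) (x : X) :
    ∃! S, S ∈ cellPartition A U n ∧ x ∈ S := by
  classical
  induction n with
  | zero =>
    have hex : ∃ n, x ∈ closure (A n) := by
      obtain ⟨n, hn⟩ := Set.mem_iUnion.1 (hcov ▸ Set.mem_univ x)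
      exact ⟨n, subset_closure hn⟩
    have hcl : ∀ n, x ∉ closure (⋃ m < n, A m) ↔ ∀ m < n, x ∉ closure (A m) := by
      intro n
      have h := (Set.finite_lt_nat n).closure_biUnion (f := A)
      simp only [Set.mem_ofPred_eq] at h
      rw [h]
      simp
    have huniq : ∀ n, x ∈ closure (A n) → x ∉ closure (⋃ m < n, A m) → n = Nat.find hex := by
      intro n h1 h2
      refine ((Nat.find_eq_iff hex).2 ⟨h1, (hcl n).1 h2⟩).symm
    have h0 : x ∉ closure (⋃ m < Nat.find hex, A m) :=
      (hcl _).2 fun m hm => Nat.find_min hex hm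
    by_cases hx : x ∈ A (Nat.find hex)
    · refine ⟨_, ⟨Or.inl ⟨Nat.find hex, rfl⟩, hx, h0⟩, ?_⟩
      rintro _ ⟨⟨n, rfl⟩ | ⟨n, rfl⟩, hxn, hxn'⟩
      · simp only [huniq n (subset_closure hxn) hxn']
      · have := huniq n (frontier_subset_closure hxn) hxn'
        rw [(hA n).frontier_eq] at hxn
        exact absurd (this ▸ hx) hxn.2
    · have hf : x ∈ frontier (A (Nat.find hex)) := by
        rw [(hA _).frontier_eq]
        exact ⟨Nat.find_spec hex, hx⟩
      refine ⟨_, ⟨Or.inr ⟨Nat.find hex, rfl⟩, hf, h0⟩, ?_⟩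
      rintro _ ⟨⟨n, rfl⟩ | ⟨n, rfl⟩, hxn, hxn'⟩
      · have := huniq n (subset_closure hxn) hxn'
        exact absurd (this ▸ hxn) hx
      · simp only [huniq n (frontier_subset_closure hxn) hxn']
  | succ n ih =>
    obtain ⟨S, ⟨hS, hxS⟩, huS⟩ := ih
    have hfr := (hU n).frontier_eq
    by_cases h1 : x ∈ U n
    · refine ⟨U n ∩ S, ⟨Or.inl (Or.inl ⟨S, hS, rfl⟩), h1, hxS⟩, ?_⟩
      rintro _ ⟨(⟨T, hT, rfl⟩ | ⟨T, hT, rfl⟩) | ⟨T, hT, rfl⟩, hx1, hx2⟩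
      · simp only [huS T ⟨hT, hx2⟩]
      · exact absurd (subset_closure h1) hx1
      · exact absurd h1 (hfr ▸ hx1).2
    · by_cases h2 : x ∈ closure (U n)
      · refine ⟨frontier (U n) ∩ S, ⟨Or.inr ⟨S, hS, rfl⟩, hfr ▸ ⟨h2, h1⟩, hxS⟩, ?_⟩
        rintro _ ⟨(⟨T, hT, rfl⟩ | ⟨T, hT, rfl⟩) | ⟨T, hT, rfl⟩, hx1, hx2⟩
        · exact absurd hx1 h1
        · exact absurd h2 hx1
        · simp only [huS T ⟨hT, hx2⟩]
      · refine ⟨(closure (U n))ᶜ ∩ S, ⟨Or.inl (Or.inr ⟨S, hS, rfl⟩), h2, hxS⟩, ?_⟩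
        rintro _ ⟨(⟨T, hT, rfl⟩ | ⟨T, hT, rfl⟩) | ⟨T, hT, rfl⟩, hx1, hx2⟩
        · exact absurd hx1 h1
        · simp only [huS T ⟨hT, hx2⟩]
        · exact absurd (frontier_subset_closure hx1) h2

theorem cell_mem [TopologicalSpace X] {A U : ℕ → Set X} (hA : ∀ n, IsOpen (A n))
    (hcov : ⋃ n, A n = Set.univ) (hU : ∀ n, IsOpen (U n)) (n : ℕ) (x : X) :
    cell A U n x ∈ cellPartition A U n ∧ x ∈ cell A U n x := by
  obtain ⟨S, hS, hu⟩ := existsUnique_cell hA hcov hU n x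
  have : {S | S ∈ cellPartition A U n ∧ x ∈ S} = {S} := by
    ext T
    exact ⟨fun hT => hu T hT, fun hT => by rw [Set.mem_singleton_iff.1 hT]; exact hS⟩
  rw [cell, this, Set.sUnion_singleton]
  exact hS

/-- The averaged kernel `Eₙ(K)`:
`Eₙ(K)(u, v) = (μ(Oₙ(u)) μ(Oₙ(v)))⁻¹ ∫_{Oₙ(u)} ∫_{Oₙ(v)} K(x, y) dμ(y) dμ(x)`. On the `μ`-null set
of points whose cell has measure zero the value is `0`. -/
def averagedKernel [TopologicalSpace X] [MeasurableSpace X] (μ : Measure X) (A U : ℕ → Set X)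
    (n : ℕ) (K : X × X → ℂ) (u v : X) : ℂ :=
  ((μ.real (cell A U n u) * μ.real (cell A U n v) : ℝ) : ℂ)⁻¹ *
    ∫ x in cell A U n u, ∫ y in cell A U n v, K (x, y) ∂μ ∂μ

end Averaging

end

/-! Positivity gives 𝒦 = R*R with R = 𝒦^(1/2), and the trace-class condition makes R
Hilbert–Schmidt. For a cell S, the integral of K over S × S is N(S) = ‖R 1_S‖². So the diagonal
average equals N(S)/μ(S)² on S, and its integral over S is N(S)/μ(S) = ‖R e_S‖², where e_S is the
normalised indicator (null cells contribute 0). The e_S of a partition are orthonormal, so Bessel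
bounds the sum over cells by the squared Hilbert–Schmidt norm of R, uniformly in n. Splitting a cell
can only increase its contribution (`norm_add_sq_div_add_le`), so the integrals increase with n and
converge to their supremum. `exists_block_integral_eq` collects all that is needed from operator
theory. -/

/-! ### Hilbert space preliminaries -/

theorem hasSum_sq_norm_inner {ι H : Type*} [NormedAddCommGroup H] [InnerProductSpace ℂ H]
    (b : HilbertBasis ι ℂ H) (x : H) : HasSum (fun i => ‖inner ℂ (b i) x‖ ^ 2) (‖x‖ ^ 2) := by
  have h := Complex.hasSum_re (b.hasSum_inner_mul_inner x x)
  convert h using 1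
  · funext i
    rw [← inner_conj_symm x (b i), RCLike.conj_mul]
    norm_cast
  · exact (inner_self_eq_norm_sq (𝕜 := ℂ) x).symm

/-- A positive trace-class operator is of the form `R* R`, with `R` Hilbert–Schmidt. -/
theorem exists_sqrt_of_isTraceClassOp {H : Type u} [NormedAddCommGroup H] [InnerProductSpace ℂ H]
    [CompleteSpace H] {T : H →L[ℂ] H} (hT : T.IsPositive) (htc : IsTraceClassOp T) :
    ∃ (R : H →L[ℂ] H) (C : ℝ), (∀ x, inner ℂ (T x) x = ((‖R x‖ ^ 2 : ℝ) : ℂ)) ∧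
      ∀ (ι : Type u) (e : ι → H), Orthonormal ℂ e → ∀ s : Finset ι, ∑ i ∈ s, ‖R (e i)‖ ^ 2 ≤ C := by
  have hT0 : 0 ≤ T := (ContinuousLinearMap.nonneg_iff_isPositive T).2 hT
  have hR : (CFC.sqrt T).IsPositive :=
    (ContinuousLinearMap.nonneg_iff_isPositive _).1 (CFC.sqrt_nonneg T)
  have hsymm : ∀ x y, inner ℂ (CFC.sqrt T x) y = inner ℂ x (CFC.sqrt T y) := hR.isSymmetric
  have hsq : ∀ x, inner ℂ (T x) x = ((‖CFC.sqrt T x‖ ^ 2 : ℝ) : ℂ) := by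
    intro x
    conv_lhs => rw [← CFC.sqrt_mul_sqrt_self T hT0]
    rw [mul_apply_eq_comp, hsymm, inner_self_eq_norm_sq_to_K]
    norm_cast
  obtain ⟨w, b, -⟩ := exists_hilbertBasis ℂ H
  have hb : Summable fun i => ‖CFC.sqrt T (b i)‖ ^ 2 := by
    convert htc w b using 2 with i
    rw [CFC.abs_of_nonneg T hT0, hsq, Complex.ofReal_re]
  refine ⟨CFC.sqrt T, ∑' j, ‖CFC.sqrt T (b j)‖ ^ 2, hsq, fun ι e he s => ?_⟩
  -- Parseval in `b` expands each `‖R (e i)‖ ^ 2`; as `R` is self-adjoint, Bessel for `e` at `R (b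
  -- j)` then bounds the `j`-th term.
  have hs : HasSum (fun j => ∑ i ∈ s, ‖inner ℂ (b j) (CFC.sqrt T (e i))‖ ^ 2)
      (∑ i ∈ s, ‖CFC.sqrt T (e i)‖ ^ 2) :=
    hasSum_sum fun i _ => hasSum_sq_norm_inner b _
  refine hasSum_le (fun j => ?_) hs hb.hasSum
  refine le_trans (le_of_eq ?_) (he.sum_inner_products_le (CFC.sqrt T (b j)) (s := s))
  refine Finset.sum_congr rfl fun i _ => ?_
  rw [← hsymm, norm_inner_symm]

/-- Cauchy–Schwarz in Engel form: this makes refinement monotone. `ha` and `hb` make it survive the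
convention `x / 0 = 0` on null sets. -/
theorem norm_add_sq_div_add_le {E : Type*} [SeminormedAddCommGroup E] {a b : E} {m k : ℝ}
    (hm : 0 ≤ m) (hk : 0 ≤ k) (ha : m = 0 → a = 0) (hb : k = 0 → b = 0) :
    ‖a + b‖ ^ 2 / (m + k) ≤ ‖a‖ ^ 2 / m + ‖b‖ ^ 2 / k := by
  rcases hm.eq_or_lt with rfl | hm
  · simp [ha rfl]
  rcases hk.eq_or_lt with rfl | hk
  · simp [hb rfl]
  have h1 : ‖a + b‖ ^ 2 ≤ (‖a‖ + ‖b‖) ^ 2 := by gcongr; exact norm_add_le a b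
  rw [div_add_div _ _ hm.ne' hk.ne', div_le_div_iff₀ (by positivity) (by positivity)]
  -- After clearing denominators and applying the triangle inequality, the two sides differ by
  -- exactly this square.
  have : 0 ≤ (‖a‖ * k - m * ‖b‖) ^ 2 := sq_nonneg _
  have h2 : ‖a + b‖ ^ 2 * (m * k) ≤ (‖a‖ + ‖b‖) ^ 2 * (m * k) := by gcongr
  nlinarith

/-- The normalised indicators of disjoint sets are orthonormal. -/
theorem orthonormal_indicatorConstLp {X ι : Type*} [MeasurableSpace X] {μ : Measure X} {S : ι → Set X}
    (hS : ∀ i, MeasurableSet (S i))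
    (hfin : ∀ i, μ (S i) ≠ ⊤) (hne : ∀ i, μ (S i) ≠ 0)
    (hd : Pairwise (Function.onFun Disjoint S)) :
    Orthonormal ℂ fun i => (((√(μ.real (S i)))⁻¹ : ℝ) : ℂ) •
      indicatorConstLp 2 (hS i) (hfin i) (1 : ℂ) := by
  classical
  rw [orthonormal_iff_ite]
  intro i j
  rw [inner_smul_left, inner_smul_right, Complex.conj_ofReal,
    L2.inner_indicatorConstLp_one_indicatorConstLp_one (hS i) (hS j) (hfin i) (hfin j)]
  split_ifs with h
  · subst h
    have h0 : 0 < μ.real (S i) := ENNReal.toReal_pos (hne i) (hfin i)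
    rw [Set.inter_self]
    have h1 : (√(μ.real (S i)))⁻¹ * ((√(μ.real (S i)))⁻¹ * μ.real (S i)) = 1 := by
      rw [← mul_assoc, ← mul_inv, Real.mul_self_sqrt h0.le, inv_mul_cancel₀ h0.ne']
    have h2 := congrArg Complex.ofReal h1
    rw [Complex.ofReal_mul, Complex.ofReal_mul, Complex.ofReal_one] at h2
    exact h2
  · rw [(hd h).inter_eq]
    simp

/-! ### Diagonal blocks of the kernel -/

section Kernel

variable {X : Type u} [MeasurableSpace X] {μ : Measure X} [SFinite μ] {K : X × X → ℂ}

theorem IsL2PositiveDefinite.isPositive {hK : MemLp K 2 (μ.prod μ)}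
    (h : IsL2PositiveDefinite hK) : (integralOperator hK).IsPositive := by
  rw [ContinuousLinearMap.isPositive_iff_complex]
  exact fun f => ⟨Complex.ext rfl (h f).2.symm, (h f).1⟩

theorem inner_integralOperator_indicatorConstLp (hK : MemLp K 2 (μ.prod μ)) {S : Set X}
    (hS : MeasurableSet S) (hμS : μ S ≠ ⊤) :
    inner ℂ (indicatorConstLp 2 hS hμS (1 : ℂ))
      (integralOperator hK (indicatorConstLp 2 hS hμS (1 : ℂ))) =
      ∫ x in S, ∫ y in S, K (x, y) ∂μ ∂μ := by
  rw [L2.inner_indicatorConstLp_one]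
  refine integral_congr_ae (ae_restrict_of_ae ?_)
  filter_upwards [integralOperator_ae_eq hK (indicatorConstLp 2 hS hμS (1 : ℂ))] with x hx
  rw [hx, ← integral_indicator hS]
  refine integral_congr_ae ?_
  filter_upwards [indicatorConstLp_coeFn (p := 2) (hs := hS) (hμs := hμS) (c := (1 : ℂ))] with y hy
  rw [hy]
  by_cases h : y ∈ S <;> simp [h]

/-- The diagonal blocks of the kernel of a positive trace-class operator. -/
theorem exists_block_integral_eq (hK : MemLp K 2 (μ.prod μ)) (hpos : IsL2PositiveDefinite hK)
    (htc : IsTraceClassOp (integralOperator hK)) :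
    ∃ (N : Set X → ℝ) (C : ℝ),
      (∀ S, MeasurableSet S → μ S ≠ ⊤ →
        ∫ x in S, ∫ y in S, K (x, y) ∂μ ∂μ = (N S : ℂ)) ∧
      (∀ S, 0 ≤ N S) ∧
      (∀ S S', MeasurableSet S → MeasurableSet S' → μ S ≠ ⊤ → μ S' ≠ ⊤ → Disjoint S S' →
        N (S ∪ S') / μ.real (S ∪ S') ≤ N S / μ.real S + N S' / μ.real S') ∧
      ∀ (ι : Type u) (S : ι → Set X), (∀ i, MeasurableSet (S i)) → (∀ i, μ (S i) ≠ ⊤) →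
        Pairwise (Function.onFun Disjoint S) →
        ∀ s : Finset ι, ∑ i ∈ s, N (S i) / μ.real (S i) ≤ C := by
  classical
  obtain ⟨R, C, hR, hC⟩ := exists_sqrt_of_isTraceClassOp hpos.isPositive htc
  -- The default value 0 makes `N` a function of the set alone, so equalities of sets can be
  -- rewritten inside it.
  let N : Set X → ℝ := fun S =>
    if h : MeasurableSet S ∧ μ S ≠ ⊤ then ‖R (indicatorConstLp 2 h.1 h.2 (1 : ℂ))‖ ^ 2 else 0
  have hN : ∀ S (hS : MeasurableSet S) (hμS : μ S ≠ ⊤),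
      N S = ‖R (indicatorConstLp 2 hS hμS (1 : ℂ))‖ ^ 2 := fun S hS hμS => dif_pos ⟨hS, hμS⟩
  have hnull : ∀ S (hS : MeasurableSet S) (hμS : μ S ≠ ⊤), μ.real S = 0 →
      R (indicatorConstLp 2 hS hμS (1 : ℂ)) = 0 := by
    intro S hS hμS h
    have : ‖indicatorConstLp 2 hS hμS (1 : ℂ)‖ = 0 := by
      rw [norm_indicatorConstLp (by norm_num) (by norm_num), h]
      simp
    rw [norm_eq_zero.1 this, map_zero]
  refine ⟨N, C, fun S hS hμS => ?_, fun S => ?_, fun S S' hS hS' hμS hμS' hd => ?_,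
    fun ι S hS hμS hd s => ?_⟩
  · rw [← inner_integralOperator_indicatorConstLp hK hS hμS, ← inner_conj_symm, hR, hN S hS hμS,
      Complex.conj_ofReal]
  · simp only [N]
    split_ifs
    · positivity
    · exact le_rfl
  · have hu : μ (S ∪ S') ≠ ⊤ := measure_union_ne_top hμS hμS'
    rw [hN S hS hμS, hN S' hS' hμS', hN _ (hS.union hS') hu,
      indicatorConstLp_disjoint_union hS hS' hμS hμS' hd, map_add,
      measureReal_union hd hS' hμS hμS']
    exact norm_add_sq_div_add_le measureReal_nonneg measureReal_nonneg (hnull S hS hμS)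
      (hnull S' hS' hμS')
  -- Null sets have no normalised indicator; they are dropped here, and their terms are 0 by
  -- division by zero.
  · have horth := orthonormal_indicatorConstLp (S := fun i : {i // μ (S i) ≠ 0} => S i)
      (fun i => hS i) (fun i => hμS i) (fun i => i.2)
      (fun i j hij => hd (Subtype.coe_injective.ne hij))
    refine le_trans (le_of_eq ?_) (hC _ _ horth (s.subtype _))
    rw [Finset.sum_subtype_eq_sum_filter
      (f := fun i => ‖R ((((√(μ.real (S i)))⁻¹ : ℝ) : ℂ) •
        indicatorConstLp 2 (hS i) (hμS i) (1 : ℂ))‖ ^ 2), Finset.sum_filter]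
    refine Finset.sum_congr rfl fun i _ => ?_
    split_ifs with h
    · rw [map_smul, norm_smul, mul_pow, hN _ (hS i) (hμS i), Complex.norm_real, norm_inv, inv_pow,
        Real.norm_of_nonneg (Real.sqrt_nonneg _), Real.sq_sqrt measureReal_nonneg]
      ring
    · rw [not_not] at h
      simp [measureReal_def, h]

end Kernel

/-! ### Cells: countability, measurability, finite measure -/

section Cells

variable {X : Type u} [TopologicalSpace X] {A U : ℕ → Set X}

theorem countable_cellPartition (A U : ℕ → Set X) (n : ℕ) : (cellPartition A U n).Countable := by
  induction n with
  | zero => exact (Set.countable_range _).union (Set.countable_range _)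
  | succ n ih => exact ((ih.image _).union (ih.image _)).union (ih.image _)

/-- Refinement only shrinks cells, so the compact closures of stage 0 keep every later cell of
finite measure. -/
theorem exists_subset_closure_of_mem_cellPartition {n : ℕ} {S : Set X}
    (hS : S ∈ cellPartition A U n) : ∃ m, S ⊆ closure (A m) := by
  induction n generalizing S with
  | zero =>
    rcases hS with ⟨m, rfl⟩ | ⟨m, rfl⟩
    · exact ⟨m, Set.sdiff_subset.trans subset_closure⟩
    · exact ⟨m, Set.sdiff_subset.trans frontier_subset_closure⟩
  | succ n ih =>
    rcases hS with (⟨T, hT, rfl⟩ | ⟨T, hT, rfl⟩) | ⟨T, hT, rfl⟩ <;>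
    · obtain ⟨m, hm⟩ := ih hT
      exact ⟨m, Set.inter_subset_right.trans hm⟩

theorem measurableSet_of_mem_cellPartition [MeasurableSpace X] [BorelSpace X]
    (hA : ∀ n, IsOpen (A n)) (hU : ∀ n, IsOpen (U n)) {n : ℕ} {S : Set X}
    (hS : S ∈ cellPartition A U n) : MeasurableSet S := by
  induction n generalizing S with
  | zero =>
    rcases hS with ⟨m, rfl⟩ | ⟨m, rfl⟩
    · exact (hA m).measurableSet.diff isClosed_closure.measurableSet
    · exact isClosed_frontier.measurableSet.diff isClosed_closure.measurableSet
  | succ n ih =>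
    rcases hS with (⟨T, hT, rfl⟩ | ⟨T, hT, rfl⟩) | ⟨T, hT, rfl⟩
    · exact (hU n).measurableSet.inter (ih hT)
    · exact isClosed_closure.measurableSet.compl.inter (ih hT)
    · exact isClosed_frontier.measurableSet.inter (ih hT)

theorem cell_eq_of_mem (hA : ∀ n, IsOpen (A n)) (hcov : ⋃ n, A n = Set.univ)
    (hU : ∀ n, IsOpen (U n)) {n : ℕ} {S : Set X} (hS : S ∈ cellPartition A U n) {x : X}
    (hx : x ∈ S) : cell A U n x = S :=
  (existsUnique_cell hA hcov hU n x).unique (cell_mem hA hcov hU n x) ⟨hS, hx⟩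

theorem pairwise_disjoint_cellPartition (hA : ∀ n, IsOpen (A n)) (hcov : ⋃ n, A n = Set.univ)
    (hU : ∀ n, IsOpen (U n)) (n : ℕ) :
    Pairwise (Function.onFun Disjoint ((↑) : cellPartition A U n → Set X)) := by
  intro S T hST
  refine Set.disjoint_left.2 fun x hxS hxT => hST (Subtype.ext ?_)
  rw [← cell_eq_of_mem hA hcov hU S.2 hxS, cell_eq_of_mem hA hcov hU T.2 hxT]

theorem iUnion_cellPartition (hA : ∀ n, IsOpen (A n)) (hcov : ⋃ n, A n = Set.univ)
    (hU : ∀ n, IsOpen (U n)) (n : ℕ) : ⋃ S : cellPartition A U n, (S : Set X) = Set.univ :=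
  Set.eq_univ_of_forall fun x =>
    Set.mem_iUnion.2 ⟨⟨_, (cell_mem hA hcov hU n x).1⟩, (cell_mem hA hcov hU n x).2⟩

theorem measure_ne_top_of_mem_cellPartition [MeasurableSpace X] {μ : Measure X}
    [IsFiniteMeasureOnCompacts μ] (hA : ∀ n, IsCompact (closure (A n))) {n : ℕ} {S : Set X}
    (hS : S ∈ cellPartition A U n) : μ S ≠ ⊤ := by
  obtain ⟨m, hm⟩ := exists_subset_closure_of_mem_cellPartition hS
  exact measure_ne_top_of_subset hm (hA m).measure_lt_top.ne

end Cells

/-! ### Monotone convergence of the averaged traces -/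

theorem theorem4p11 {X : Type u} [TopologicalSpace X] [T2Space X] [LocallyCompactSpace X]
    [SecondCountableTopology X] [MeasurableSpace X] [BorelSpace X]
    (μ : Measure X) [SigmaFinite μ] [IsLocallyFiniteMeasure μ] [μ.IsOpenPosMeasure]
    (A : ℕ → Set X) (hA_open : ∀ n, IsOpen (A n)) (hA_cpt : ∀ n, IsCompact (closure (A n)))
    (hA_cover : ⋃ n, A n = Set.univ)
    (U : ℕ → Set X) (hU : TopologicalSpace.IsTopologicalBasis (Set.range U))
    (K : X × X → ℂ) (hK : MemLp K 2 (μ.prod μ))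
    (hpos : IsL2PositiveDefinite hK) (htc : IsTraceClassOp (integralOperator hK)) :
    (∀ n, Integrable (fun x => averagedKernel μ A U n K x x) μ) ∧
    ∃ L : ℝ, Tendsto (fun n => ∫ x, averagedKernel μ A U n K x x ∂μ) atTop (𝓝 (L : ℂ)) := by
  have hU' : ∀ n, IsOpen (U n) := fun n => hU.isOpen ⟨n, rfl⟩
  obtain ⟨N, C, hN, hN0, hNadd, hNC⟩ := exists_block_integral_eq hK hpos htc
  have hmeas : ∀ {n S}, S ∈ cellPartition A U n → MeasurableSet S :=
    fun hS => measurableSet_of_mem_cellPartition hA_open hU' hS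
  have hfin : ∀ {n S}, S ∈ cellPartition A U n → μ S ≠ ⊤ :=
    fun hS => measure_ne_top_of_mem_cellPartition hA_cpt hS
  have hdisj := pairwise_disjoint_cellPartition (A := A) (U := U) hA_open hA_cover hU'
  have hcount : ∀ n, Countable (cellPartition A U n) := fun n =>
    (countable_cellPartition A U n).to_subtype
  let g : ℕ → X → ℝ := fun n x =>
    (μ.real (cell A U n x) * μ.real (cell A U n x))⁻¹ * N (cell A U n x)
  have hg : ∀ n x, averagedKernel μ A U n K x x = (g n x : ℂ) := by
    intro n x
    have hc := (cell_mem hA_open hA_cover hU' n x).1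
    rw [averagedKernel, hN _ (hmeas hc) (hfin hc)]
    push_cast [g]
    rfl
  have hgS : ∀ {n S}, S ∈ cellPartition A U n →
      Set.EqOn (g n) (fun _ => (μ.real S * μ.real S)⁻¹ * N S) S := by
    intro n S hS x hx
    simp only [g, cell_eq_of_mem hA_open hA_cover hU' hS hx]
  have hgnorm : ∀ n x, ‖g n x‖ = g n x := fun n x =>
    Real.norm_of_nonneg (mul_nonneg (by positivity) (hN0 _))
  have hgint : ∀ {n S}, S ∈ cellPartition A U n → IntegrableOn (g n) S μ := fun {n S} hS =>
    (integrableOn_congr_fun (hgS hS) (hmeas hS)).2 (integrableOn_const (hfin hS))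
  have hgval : ∀ {n S}, S ∈ cellPartition A U n → ∫ x in S, g n x ∂μ = N S / μ.real S := by
    intro n S hS
    rw [setIntegral_congr_fun (hmeas hS) (hgS hS), setIntegral_const, smul_eq_mul]
    by_cases h : μ.real S = 0
    · simp [h]
    · field_simp
  have hint : ∀ n, Integrable (g n) μ := by
    intro n
    rw [← integrableOn_univ, ← iUnion_cellPartition (A := A) (U := U) hA_open hA_cover hU' n]
    refine integrableOn_iUnion_of_summable_integral_norm (fun S => hgint S.2) ?_
    simp only [hgnorm, hgval (Subtype.prop _)]
    exact summable_of_sum_le (fun S => div_nonneg (hN0 _) measureReal_nonneg)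
      (hNC _ _ (fun S => hmeas S.2) (fun S => hfin S.2) (hdisj n))
  have hsum : ∀ n (f : X → ℝ), Integrable f μ →
      HasSum (fun S : cellPartition A U n => ∫ x in (S : Set X), f x ∂μ) (∫ x, f x ∂μ) := by
    intro n f hf
    have := hasSum_integral_iUnion (fun S : cellPartition A U n => hmeas S.2) (hdisj n)
      (hf.integrableOn (μ := μ))
    rwa [iUnion_cellPartition hA_open hA_cover hU' n, setIntegral_univ] at this
  have hbdd : ∀ n, ∫ x, g n x ∂μ ≤ C := by
    intro n
    refine hasSum_le_of_sum_le (hsum n _ (hint n)) fun s => ?_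
    simp only [hgval (Subtype.prop _)]
    exact hNC _ _ (fun S => hmeas S.2) (fun S => hfin S.2) (hdisj n) s
  have hmono : Monotone fun n => ∫ x, g n x ∂μ := by
    refine monotone_nat_of_le_succ fun n => ?_
    -- Both integrals are split along the coarser partition, so the comparison is made inside a
    -- single cell `S` and its three pieces.
    refine hasSum_le (fun S => ?_) (hsum n _ (hint n)) (hsum n _ (hint (n + 1)))
    have h1 : U n ∩ S ∈ cellPartition A U (n + 1) := Or.inl (Or.inl ⟨S, S.2, rfl⟩)
    have h2 : (closure (U n))ᶜ ∩ S ∈ cellPartition A U (n + 1) := Or.inl (Or.inr ⟨S, S.2, rfl⟩)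
    have h3 : frontier (U n) ∩ S ∈ cellPartition A U (n + 1) := Or.inr ⟨S, S.2, rfl⟩
    have d12 : Disjoint (U n ∩ S) ((closure (U n))ᶜ ∩ S) :=
      Set.disjoint_left.2 fun x hx hx' => hx'.1 (subset_closure hx.1)
    have d3 : Disjoint (U n ∩ S ∪ (closure (U n))ᶜ ∩ S) (frontier (U n) ∩ S) := by
      rw [(hU' n).frontier_eq]
      refine Set.disjoint_left.2 fun x hx hx' => ?_
      rcases hx with hx | hx
      · exact hx'.1.2 hx.1
      · exact hx.1 hx'.1.1
    have hS : (S : Set X) = U n ∩ S ∪ (closure (U n))ᶜ ∩ S ∪ frontier (U n) ∩ S := by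
      rw [← Set.union_inter_distrib_right, ← Set.union_inter_distrib_right, (hU' n).frontier_eq]
      refine (Set.inter_eq_right.2 fun x _ => ?_).symm
      by_cases hx : x ∈ U n <;> by_cases hx' : x ∈ closure (U n) <;> simp [hx, hx']
    have hi := hint (n + 1)
    have key : ∫ x in (S : Set X), g (n + 1) x ∂μ =
        N (U n ∩ S) / μ.real (U n ∩ S) +
        N ((closure (U n))ᶜ ∩ S) / μ.real ((closure (U n))ᶜ ∩ S) +
        N (frontier (U n) ∩ S) / μ.real (frontier (U n) ∩ S) := by
      conv_lhs => rw [hS]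
      rw [setIntegral_union d3 (hmeas h3) hi.integrableOn hi.integrableOn,
        setIntegral_union d12 (hmeas h2) hi.integrableOn hi.integrableOn,
        hgval h1, hgval h2, hgval h3]
    rw [hgval S.2, key]
    conv_lhs => rw [hS]
    -- The two-set inequality is applied twice: first to split off the frontier piece, then to
    -- separate the other two.
    exact (hNadd _ _ ((hmeas h1).union (hmeas h2)) (hmeas h3)
      (measure_union_ne_top (hfin h1) (hfin h2)) (hfin h3) d3).trans
      (add_le_add (hNadd _ _ (hmeas h1) (hmeas h2) (hfin h1) (hfin h2) d12) le_rfl)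
  simp only [hg]
  refine ⟨fun n => (hint n).ofReal, ⨆ n, ∫ x, g n x ∂μ, ?_⟩
  simp only [integral_complex_ofReal]
  exact (Complex.continuous_ofReal.tendsto _).comp
    (tendsto_atTop_ciSup hmono ⟨C, Set.forall_mem_range.2 hbdd⟩)
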